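/- **Theorem (comparison of Weibull and Beta Median plotting positions).** For integers $n\ge 1$ and $1\le i\le n$ let $p_i^W=\frac{i}{n+1}$ and let $p_i^B$ be the median of the Beta distribution $\mathrm{Beta}(i,n+1-i)$, i.e. of the law on $[0,1]$ with density $\frac{\Gamma(n+1)}{\Gamma(i)\Gamma(n+1-i)}x^{i-1}(1-x)^{n-i}$ (both depend on $n$). Write $[m]$ for the largest integer $\le m$. Then for every $n>2$: (a) $0<p_i^W-p_i^B<\dfrac{|n+1-2i|}{n^2-1}$ for $1\le i\le[n/2]$. (b) $0<p_i^B-p_i^W<\dfrac{|n+1-2i|}{n^2-1}$ for $[n/2]+1\le i\le n$ with $i\ne\frac{n+1}{2}$. (c) $p_i^W=p_i^B$ for $i=\frac{n+1}{2}$, if $n$ is odd. (d) $|p_i^W-p_i^B|<\dfrac1{n+1}$ and $\dfrac{|n+1-2i|}{n^2-1}\le\dfrac1{n+1}$ for $1\le i\le n$. (e) $0<p_1^B<p_1^W<1$ and $0<p_n^W<p_n^B<1$. (f) $p_{i-1}^W<p_i^B<p_i^W$ for $2\le i\le[n/2]$. (g) For $[n/2]+1\le i\le n-1$: $p_{i-1}^B<p_i^W$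 and $p_i^B<p_{i+1}^W$; and if moreover $i\ne\frac{n+1}2$, then $p_i^W<p_i^B$. (Hence $p_{i-1}^B<p_i^W<p_i^B<p_{i+1}^W$ for these $i\neq\frac{n+1}{2}$.) (h) For $1\le i\le n$: $\left|\dfrac{p_i^B}{p_i^W}-1\right|<\dfrac1i$. Moreover $\left|\dfrac{p_i^B}{p_i^W}-1\right|<\dfrac{|n+1-2i|}{i(n-1)}$ if $i\ne\frac{n+1}2$, and $\dfrac{|n+1-2i|}{i(n-1)}\le\dfrac1i$, with strict inequality if $1<i<n$. (i) For $1\le i\le n$: $\left|\dfrac{1-p_i^B}{1-p_i^W}-1\right|<\dfrac1{n+1-i}$. Moreover $\left|\dfrac{1-p_i^B}{1-p_i^W}-1\right|<\dfrac{|n+1-2i|}{(n+1-i)(n-1)}$ if $i\ne\frac{n+1}2$; and $\dfrac{|n+1-2i|}{(n+1-i)(n-1)}\le\dfrac1{n+1-i}$, with strict inequality if $1<i<n$; and $\dfrac{|n+1-2i|}{(n+1-i)(n-1)}<\dfrac1{n-i}$ if $i<n$. Finally, (j) $\displaystyle\lim_{n\to\infty}\frac{p_1^B}{p_1^W}=\lim_{n\to\infty}\frac{1-p_n^B}{1-p_n^W}=\log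 2$ (natural logarithm). -/

import Mathlib

open Filter Topology MeasureTheory ProbabilityTheory

/-- The quantile function of a probability measure `μ` on `ℝ` at level `p`, the (generalised)
inverse of its distribution function: `q_μ(p) = inf {x | p ≤ μ((-∞, x])}`. -/
noncomputable def quantile (μ : Measure ℝ) (p : ℝ) : ℝ :=
  sInf {x : ℝ | p ≤ cdf μ x}

/-- The median `q_μ(1/2)` of a probability measure on `ℝ`. -/
noncomputable def median (μ : Measure ℝ) : ℝ :=
  quantile μ (1 / 2)

/-- The Weibull plotting position `p_i^W = i / (n + 1)`. -/
noncomputable def weibullPos (n i : ℕ) : ℝ :=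
  (i : ℝ) / ((n : ℝ) + 1)

/-- The Beta Median plotting position `p_i^B = Med{Beta(i, n + 1 - i)}`, for `1 ≤ i ≤ n`.
The subtraction takes place in `ℝ`. -/
noncomputable def betaMedianPos (n i : ℕ) : ℝ :=
  median (betaMeasure (i : ℝ) ((n : ℝ) + 1 - (i : ℝ)))

/-! Put p = i - 1 and q = n - i. For p < q the law Beta(p+1, q+1) satisfies mode < median < mean,
that is, p/(p+q) < p_i^B < (p+1)/(p+q+2) = p_i^W. Mean minus mode is (n+1-2i)/(n²-1), the bound in
(a). The reflection x ↦ 1 - x exchanges i and n+1-i, which settles the upper half and the middle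
index; the rest of (a)-(i) is arithmetic.

Both inequalities rest on `betaKernel_sub_lt_betaKernel_add`, the skewness of x^k (1-x)^l about its
mode when k < l. Applied to the density and integrated, it gives mode < median
(`two_mul_incompleteBeta_mode_lt`). Applied to the exponents p+1, q+1, whose mode is the mean of
Beta(p+1, q+1), it gives median < mean after an integration by parts
(`lt_two_mul_incompleteBeta_mean`). The limits (j) come from Beta(n, 1), whose median is 2^(-1/n).
-/

/-! ### The beta kernel and its primitive -/

/-- The function `x ↦ x ^ p * (1 - x) ^ q`, the unnormalised density of `Beta(p + 1, q + 1)`. -/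
noncomputable def betaKernel (p q : ℕ) (x : ℝ) : ℝ :=
  x ^ p * (1 - x) ^ q

/-- The incomplete beta function `∫ t in 0..x, t ^ p * (1 - t) ^ q`. -/
noncomputable def incompleteBeta (p q : ℕ) (x : ℝ) : ℝ :=
  ∫ t in (0 : ℝ)..x, betaKernel p q t

lemma continuous_betaKernel (p q : ℕ) : Continuous (betaKernel p q) := by
  unfold betaKernel
  fun_prop

lemma betaKernel_pos (p q : ℕ) {x : ℝ} (h₀ : 0 < x) (h₁ : x < 1) : 0 < betaKernel p q x :=
  mul_pos (pow_pos h₀ p) (pow_pos (sub_pos.2 h₁) q)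

lemma betaKernel_nonneg (p q : ℕ) {x : ℝ} (h₀ : 0 ≤ x) (h₁ : x ≤ 1) : 0 ≤ betaKernel p q x :=
  mul_nonneg (pow_nonneg h₀ p) (pow_nonneg (sub_nonneg.2 h₁) q)

lemma betaKernel_one_sub (p q : ℕ) (x : ℝ) : betaKernel p q (1 - x) = betaKernel q p x := by
  simp [betaKernel, mul_comm]

lemma hasDerivAt_betaKernel_succ (p q : ℕ) (x : ℝ) :
    HasDerivAt (betaKernel (p + 1) (q + 1))
      (((p + 1 : ℝ) - (p + q + 2) * x) * betaKernel p q x) x := by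
  have h := (hasDerivAt_pow (p + 1) x).mul (((hasDerivAt_id x).const_sub 1).pow (q + 1))
  convert! h using 1
  simp only [betaKernel, id, Pi.pow_apply]
  push_cast
  ring

lemma hasDerivAt_incompleteBeta (p q : ℕ) (x : ℝ) :
    HasDerivAt (incompleteBeta p q) (betaKernel p q x) x :=
  ((continuous_betaKernel p q).integral_hasStrictDerivAt 0 x).hasDerivAt

lemma continuous_incompleteBeta (p q : ℕ) : Continuous (incompleteBeta p q) :=
  continuous_iff_continuousAt.2 fun x => (hasDerivAt_incompleteBeta p q x).continuousAt

@[simp]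
lemma incompleteBeta_zero (p q : ℕ) : incompleteBeta p q 0 = 0 :=
  intervalIntegral.integral_same

lemma strictMonoOn_incompleteBeta (p q : ℕ) :
    StrictMonoOn (incompleteBeta p q) (Set.Icc 0 1) := by
  refine strictMonoOn_of_deriv_pos (convex_Icc 0 1)
    (continuous_incompleteBeta p q).continuousOn fun x hx => ?_
  rw [interior_Icc] at hx
  rw [(hasDerivAt_incompleteBeta p q x).deriv]
  exact betaKernel_pos p q hx.1 hx.2

lemma incompleteBeta_one_pos (p q : ℕ) : 0 < incompleteBeta p q 1 := by
  simpa using strictMonoOn_incompleteBeta p q (by simp) (by simp) zero_lt_one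

lemma incompleteBeta_one_sub (p q : ℕ) (x : ℝ) :
    incompleteBeta p q (1 - x) = incompleteBeta q p 1 - incompleteBeta q p x := by
  have h := intervalIntegral.integral_comp_sub_left (a := x) (b := 1) (betaKernel p q) 1
  simp only [betaKernel_one_sub, sub_self] at h
  rw [incompleteBeta, ← h, incompleteBeta, incompleteBeta,
    intervalIntegral.integral_interval_sub_left] <;>
  exact (continuous_betaKernel q p).intervalIntegrable _ _

/-! ### Skewness of the kernel about its mode -/

/-- By the power series, c (log(1+u/c) - log(1-u/c)) = 2 ∑ u^(2j+1) / ((2j+1) c^(2j)); the term j =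
0 does not depend on c and all others strictly decrease in c. -/
lemma mul_log_sub_log_lt {k l u : ℝ} (hu : 0 < u) (huk : u < k) (hkl : k < l) :
    l * (Real.log (1 + u / l) - Real.log (1 - u / l)) <
      k * (Real.log (1 + u / k) - Real.log (1 - u / k)) := by
  have hk : 0 < k := hu.trans huk
  have hl : 0 < l := hk.trans hkl
  have hlt : u / l < u / k := div_lt_div_of_pos_left hu hk hkl
  have bound : ∀ {c : ℝ}, 0 < c → u < c → |u / c| < 1 := fun hc huc => by
    rw [abs_of_pos (div_pos hu hc)]
    exact (div_lt_one hc).2 huc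
  have term : ∀ (c : ℝ), 0 < c → ∀ j : ℕ, c * (2 * (1 / (2 * j + 1)) * (u / c) ^ (2 * j + 1)) =
      2 * (1 / (2 * (j : ℝ) + 1)) * u * (u / c) ^ (2 * j) := fun c hc j => by
    rw [pow_succ]
    field_simp
  refine hasSum_lt (i := 1) (fun j => ?_) ?_
    ((Real.hasSum_log_sub_log_of_abs_lt_one (bound hl (huk.trans hkl))).mul_left l)
    ((Real.hasSum_log_sub_log_of_abs_lt_one (bound hk huk)).mul_left k)
  · rw [term l hl, term k hk]
    gcongr
  · rw [term l hl, term k hk]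
    gcongr

lemma pow_mul_pow_lt_pow_mul_pow {k l : ℕ} (hk : 0 < k) (hkl : k < l) {u : ℝ} (hu : 0 < u)
    (huk : u ≤ k) :
    ((k : ℝ) - u) ^ k * ((l : ℝ) + u) ^ l < ((k : ℝ) + u) ^ k * ((l : ℝ) - u) ^ l := by
  have hk' : (0 : ℝ) < k := by exact_mod_cast hk
  have hkl' : (k : ℝ) < l := by exact_mod_cast hkl
  have hl' := hk'.trans hkl'
  -- At u = k the left side vanishes, so logarithms cannot be taken.
  rcases huk.eq_or_lt with rfl | huk
  · rw [sub_self, zero_pow hk.ne', zero_mul]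
    exact mul_pos (by positivity) (pow_pos (by linarith) l)
  have h := mul_log_sub_log_lt hu huk hkl'
  have e : ∀ {c : ℝ}, 0 < c → u < c → Real.log (1 + u / c) - Real.log (1 - u / c) =
      Real.log (c + u) - Real.log (c - u) := fun {c} hc huc => by
    rw [show 1 + u / c = (c + u) / c by field_simp, show 1 - u / c = (c - u) / c by field_simp,
      Real.log_div (by linarith) hc.ne', Real.log_div (by linarith) hc.ne']
    ring
  rw [e hl' (huk.trans hkl'), e hk' huk] at h
  have h1 : 0 < (k : ℝ) - u := by linarith
  have h2 : 0 < (l : ℝ) - u := by linarith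
  rw [← Real.log_lt_log_iff (by positivity) (by positivity), Real.log_mul (by positivity)
    (by positivity), Real.log_mul (by positivity) (by positivity)]
  simp only [Real.log_pow]
  linarith

/-- Around its mode `k / (k + l)`, the kernel with `0 < k < l` is larger on the right. -/
lemma betaKernel_sub_lt_betaKernel_add {k l : ℕ} (hk : 0 < k) (hkl : k < l) {t : ℝ} (ht : 0 < t)
    (htk : t ≤ (k : ℝ) / (k + l)) :
    betaKernel k l ((k : ℝ) / (k + l) - t) < betaKernel k l ((k : ℝ) / (k + l) + t) := by
  have hs : (0 : ℝ) < k + l := by positivity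
  -- With u = t(k+l), the four bases are k+l times the values of x and 1-x at the two points.
  have h := pow_mul_pow_lt_pow_mul_pow hk hkl (mul_pos ht hs) ((le_div_iff₀ hs).1 htk)
  have e1 : (k : ℝ) - t * (k + l) = (k + l) * ((k : ℝ) / (k + l) - t) := by field_simp
  have e2 : (l : ℝ) + t * (k + l) = (k + l) * (1 - ((k : ℝ) / (k + l) - t)) := by
    field_simp
    ring
  have e3 : (k : ℝ) + t * (k + l) = (k + l) * ((k : ℝ) / (k + l) + t) := by field_simp
  have e4 : (l : ℝ) - t * (k + l) = (k + l) * (1 - ((k : ℝ) / (k + l) + t)) := by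
    field_simp
    ring
  rw [e1, e2, e3, e4] at h
  simp only [mul_pow] at h
  refine lt_of_mul_lt_mul_left (a := ((k : ℝ) + l) ^ k * ((k : ℝ) + l) ^ l) ?_ (by positivity)
  unfold betaKernel
  linarith

/-! ### Mode, median and mean -/

/-- The mode lies below the median. -/
lemma two_mul_incompleteBeta_mode_lt {p q : ℕ} (hpq : p < q) :
    2 * incompleteBeta p q ((p : ℝ) / (p + q)) < incompleteBeta p q 1 := by
  rcases p.eq_zero_or_pos with rfl | hp
  · simpa using incompleteBeta_one_pos 0 q
  have hpq' : (p : ℝ) < q := by exact_mod_cast hpq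
  have hp' : (0 : ℝ) < p := by exact_mod_cast hp
  set m : ℝ := (p : ℝ) / (p + q) with hm
  have hm0 : 0 < m := by positivity
  have hm1 : 2 * m < 1 := by
    rw [hm, ← mul_div_assoc, div_lt_one (by positivity)]
    linarith
  have hd : ∀ t, HasDerivAt (fun t => incompleteBeta p q (m + t) + incompleteBeta p q (m - t))
      (betaKernel p q (m + t) - betaKernel p q (m - t)) t := fun t => by
    have h1 := (hasDerivAt_incompleteBeta p q (m + t)).comp_const_add m t
    have h2 := (hasDerivAt_incompleteBeta p q (m - t)).comp_const_sub m t
    exact h1.add h2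
  -- This function runs from 2F(m) at t = 0 to F(2m) at t = m, where F is the incomplete beta
  -- function, and F(2m) < F(1) because 2m < 1.
  have hmono : StrictMonoOn (fun t => incompleteBeta p q (m + t) + incompleteBeta p q (m - t))
      (Set.Icc 0 m) := by
    refine strictMonoOn_of_deriv_pos (convex_Icc 0 m)
      (fun t _ => (hd t).continuousAt.continuousWithinAt) fun t ht => ?_
    rw [interior_Icc] at ht
    rw [(hd t).deriv]
    exact sub_pos.2 (betaKernel_sub_lt_betaKernel_add hp hpq ht.1 ht.2.le)
  have h := hmono (by simp [hm0.le]) (by simp [hm0.le]) hm0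
  simp only [add_zero, sub_zero, sub_self, incompleteBeta_zero] at h
  have h' := strictMonoOn_incompleteBeta p q (a := m + m) (b := 1)
    ⟨by linarith, by linarith⟩ (by simp) (by linarith)
  linarith

/-- The mean lies above the median. -/
lemma lt_two_mul_incompleteBeta_mean {p q : ℕ} (hpq : p < q) :
    incompleteBeta p q 1 < 2 * incompleteBeta p q (((p : ℝ) + 1) / (p + q + 2)) := by
  have hpq' : (p : ℝ) < q := by exact_mod_cast hpq
  set N : ℝ := p + q + 2 with hN
  have hN0 : 0 < N := by positivity
  set m : ℝ := ((p : ℝ) + 1) / N with hm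
  have hNm : N * m = p + 1 := by
    rw [hm]
    field_simp
  have hm0 : 0 < m := by positivity
  have hm1 : 2 * m < 1 := by
    rw [hm, ← mul_div_assoc, div_lt_one hN0]
    linarith
  set G := betaKernel (p + 1) (q + 1) with hG
  have hGd : ∀ x, HasDerivAt G (N * (m - x) * betaKernel p q x) x := fun x => by
    convert! hasDerivAt_betaKernel_succ p q x using 2
    rw [mul_sub, hNm]
  set D : ℝ → ℝ := fun t => G (m + t) - G (m - t) with hD
  have hDd : ∀ t, HasDerivAt D (N * t * (betaKernel p q (m - t) - betaKernel p q (m + t))) t :=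
    fun t => by
    convert! ((hGd (m + t)).comp_const_add m t).sub ((hGd (m - t)).comp_const_sub m t) using 1
    ring
  -- The mean m is the mode of G, so skewness applies to G.
  have hDpos : ∀ t, 0 < t → t ≤ m → 0 < D t := fun t ht htm => by
    have e : m = ((p + 1 : ℕ) : ℝ) / ((p + 1 : ℕ) + (q + 1 : ℕ)) := by
      rw [hm, hN]
      push_cast
      ring_nf
    have := betaKernel_sub_lt_betaKernel_add (k := p + 1) (l := q + 1) p.succ_pos (by omega) ht
      (htm.trans_eq e)
    rw [← e] at this
    exact sub_pos.2 this
  have hD0 : D 0 = 0 := by simp [hD]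
  -- `dslope` extends D(t)/t continuously to t = 0, with value D'(0) = 0.
  have hslope : ∀ t, t ≠ 0 → dslope D 0 t = D t / t := fun t ht => by
    rw [dslope_of_ne _ ht, slope_def_field, hD0, sub_zero, sub_zero]
  have hslope_d : ∀ t, t ≠ 0 → HasDerivAt (dslope D 0)
      (N * (betaKernel p q (m - t) - betaKernel p q (m + t)) - D t / t ^ 2) t := fun t ht => by
    have h := (hDd t).div (hasDerivAt_id t) ht
    refine (h.congr_of_eventuallyEq ?_).congr_deriv ?_
    · filter_upwards [isOpen_ne.mem_nhds ht] with s hs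
      exact hslope s hs
    · simp only [id]
      field_simp
  -- Integration by parts: f(m-t) - f(m+t) = D'(t)/(Nt) for the kernel f, and subtracting (D(t)/t)/N
  -- from its primitive leaves the derivative D(t)/(Nt²) > 0. Comparing t = 0 with t = m gives F(2m)
  -- + G(2m)/(Nm) < 2F(m).
  set Ψ : ℝ → ℝ := fun t =>
    -incompleteBeta p q (m - t) - incompleteBeta p q (m + t) - dslope D 0 t / N with hΨ
  have hΨd : ∀ t, t ≠ 0 → HasDerivAt Ψ (D t / t ^ 2 / N) t := fun t ht => by
    have h1 := (hasDerivAt_incompleteBeta p q (m + t)).comp_const_add m t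
    have h2 := (hasDerivAt_incompleteBeta p q (m - t)).comp_const_sub m t
    refine ((h2.neg.sub h1).sub ((hslope_d t ht).div_const N)).congr_deriv ?_
    field_simp
    ring
  have hslope_c : Continuous (dslope D 0) := continuous_iff_continuousAt.2 fun t => by
    rcases eq_or_ne t 0 with rfl | ht
    · exact continuousAt_dslope_same.2 (hDd 0).differentiableAt
    · exact (hslope_d t ht).continuousAt
  have hF := continuous_incompleteBeta p q
  have hmono : StrictMonoOn Ψ (Set.Icc 0 m) := by
    refine strictMonoOn_of_deriv_pos (convex_Icc 0 m) (Continuous.continuousOn ?_) fun t ht => ?_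
    · fun_prop
    · rw [interior_Icc] at ht
      rw [(hΨd t ht.1.ne').deriv]
      have := hDpos t ht.1 ht.2.le
      have := ht.1
      positivity
  have h := hmono (by simp [hm0.le]) (by simp [hm0.le]) hm0
  have hDm : D m = G (m + m) := by simp [hD, hG, betaKernel]
  simp only [hΨ, sub_zero, add_zero, sub_self, incompleteBeta_zero, dslope_same, (hDd 0).deriv,
    mul_zero, zero_div, hslope m hm0.ne', hDm] at h
  -- The boundary term G(2m)/(Nm) pays for the mass beyond 2m: F + G/(Nm) is nonincreasing on [2m,
  -- 1] and equals F(1) at 1.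
  have hKd : ∀ x, HasDerivAt (fun x => incompleteBeta p q x + G x / m / N)
      (betaKernel p q x * (2 * m - x) / m) x := fun x => by
    refine ((hasDerivAt_incompleteBeta p q x).add
      (((hGd x).div_const m).div_const N)).congr_deriv ?_
    field_simp
    ring
  have hanti : AntitoneOn (fun x => incompleteBeta p q x + G x / m / N) (Set.Icc (m + m) 1) := by
    refine antitoneOn_of_deriv_nonpos (convex_Icc _ _)
      (fun x _ => (hKd x).continuousAt.continuousWithinAt)
      (fun x _ => (hKd x).differentiableAt.differentiableWithinAt) fun x hx => ?_
    rw [interior_Icc] at hx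
    rw [(hKd x).deriv]
    refine div_nonpos_of_nonpos_of_nonneg (mul_nonpos_of_nonneg_of_nonpos
      (betaKernel_nonneg p q ?_ hx.2.le) ?_) hm0.le <;>
    linarith [hx.1]
  have h' := hanti (a := m + m) (b := 1) ⟨le_rfl, by linarith⟩ ⟨by linarith, le_rfl⟩ (by linarith)
  have hG1 : G 1 = 0 := by simp [hG, betaKernel]
  simp only [hG1, zero_div, add_zero] at h'
  linarith

/-! ### Distribution function and median of the Beta law -/

lemma betaPDF_natCast_add_one (p q : ℕ) (x : ℝ) :
    betaPDF (p + 1) (q + 1) x = (Set.Ioo (0 : ℝ) 1).indicator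
      (fun x => ENNReal.ofReal (1 / beta (p + 1) (q + 1) * betaKernel p q x)) x := by
  rw [betaPDF_eq, Set.indicator_apply]
  simp only [Set.mem_Ioo]
  split_ifs
  · simp [betaKernel, mul_assoc]
  · simp

lemma betaMeasure_Iic (p q : ℕ) {x : ℝ} (h₀ : 0 ≤ x) (h₁ : x ≤ 1) :
    betaMeasure (p + 1) (q + 1) (Set.Iic x) =
      ENNReal.ofReal (1 / beta (p + 1) (q + 1) * incompleteBeta p q x) := by
  have hb : 0 < beta (p + 1) (q + 1) := beta_pos (by positivity) (by positivity)
  have hs : (Set.Iic x ∩ Set.Ioo 0 1 : Set ℝ) =ᵐ[volume] Set.Ioc 0 x := by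
    have : Set.Ioc 0 x = Set.Iic x ∩ Set.Ioc 0 1 := by
      ext y
      simp only [Set.mem_Ioc, Set.mem_inter_iff, Set.mem_Iic]
      grind
    rw [this]
    exact (ae_eq_refl _).inter Ioo_ae_eq_Ioc
  rw [betaMeasure, withDensity_apply _ measurableSet_Iic,
    lintegral_congr (betaPDF_natCast_add_one p q), setLIntegral_indicator measurableSet_Ioo,
    Set.inter_comm, Measure.restrict_congr_set hs, incompleteBeta,
    intervalIntegral.integral_of_le h₀, ← integral_const_mul,
    ofReal_integral_eq_lintegral_ofReal]
  · exact ((((continuous_betaKernel p q).const_mul _).continuousOn).integrableOn_Icc).mono_set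
      Set.Ioc_subset_Icc_self
  · refine ae_restrict_of_forall_mem measurableSet_Ioc fun y hy => ?_
    exact mul_nonneg (by positivity) (betaKernel_nonneg p q hy.1.le (hy.2.trans h₁))

lemma betaMeasure_Iic_one (p q : ℕ) : betaMeasure (p + 1) (q + 1) (Set.Iic 1) = 1 := by
  have := isProbabilityMeasureBeta (α := p + 1) (β := q + 1) (by positivity) (by positivity)
  rw [prob_compl_eq_zero_iff measurableSet_Iic |>.symm, Set.compl_Iic, betaMeasure,
    withDensity_apply _ measurableSet_Ioi]
  exact setLIntegral_eq_zero measurableSet_Ioi fun x hx => betaPDF_eq_zero_of_one_le hx.le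

lemma cdf_betaMeasure (p q : ℕ) {x : ℝ} (h₀ : 0 ≤ x) (h₁ : x ≤ 1) :
    cdf (betaMeasure (p + 1) (q + 1)) x = incompleteBeta p q x / incompleteBeta p q 1 := by
  have := isProbabilityMeasureBeta (α := p + 1) (β := q + 1) (by positivity) (by positivity)
  have hb : 0 < beta (p + 1) (q + 1) := beta_pos (by positivity) (by positivity)
  -- Total mass one identifies the normalising constant with 1/F(1).
  have h1 := betaMeasure_Iic p q zero_le_one le_rfl
  rw [betaMeasure_Iic_one, eq_comm, ENNReal.ofReal_eq_one] at h1
  have h2 : 0 ≤ incompleteBeta p q x := by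
    simpa using (strictMonoOn_incompleteBeta p q).monotoneOn (by simp) ⟨h₀, h₁⟩ h₀
  rw [cdf_eq_real, Measure.real, betaMeasure_Iic p q h₀ h₁, ENNReal.toReal_ofReal (by positivity),
    eq_div_iff (incompleteBeta_one_pos p q).ne']
  linear_combination incompleteBeta p q x * h1

lemma median_betaMeasure_eq {p q : ℕ} {x : ℝ} (h₀ : 0 ≤ x) (h₁ : x ≤ 1)
    (hx : 2 * incompleteBeta p q x = incompleteBeta p q 1) :
    median (betaMeasure (p + 1) (q + 1)) = x := by
  have hpos := incompleteBeta_one_pos p q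
  refine IsLeast.csInf_eq ⟨?_, fun y hy => ?_⟩
  · rw [Set.mem_ofPred_eq, cdf_betaMeasure p q h₀ h₁, le_div_iff₀ hpos]
    linarith
  · by_contra! hlt
    -- The formula for the distribution function holds only on [0, 1], so a negative y is replaced
    -- by 0.
    have hle := monotone_cdf (betaMeasure (p + 1) (q + 1)) (le_max_left y 0)
    have hlt' : max y 0 < x := max_lt hlt (h₀.lt_of_ne (by rintro rfl; simp at hx; linarith))
    have hmem : max y 0 ∈ Set.Icc (0 : ℝ) 1 := ⟨le_max_right _ _, hlt'.le.trans h₁⟩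
    rw [cdf_betaMeasure p q hmem.1 hmem.2] at hle
    have := strictMonoOn_incompleteBeta p q hmem ⟨h₀, h₁⟩ hlt'
    have h3 := (le_div_iff₀ hpos).1 (le_trans hy hle)
    linarith

lemma median_betaMeasure_spec (p q : ℕ) :
    median (betaMeasure (p + 1) (q + 1)) ∈ Set.Ioo (0 : ℝ) 1 ∧
      2 * incompleteBeta p q (median (betaMeasure (p + 1) (q + 1))) = incompleteBeta p q 1 := by
  have hpos := incompleteBeta_one_pos p q
  obtain ⟨x, hx, hxe⟩ := intermediate_value_Ioo zero_le_one
    (continuous_incompleteBeta p q).continuousOn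
    (show incompleteBeta p q 1 / 2 ∈ Set.Ioo (incompleteBeta p q 0) (incompleteBeta p q 1) by
      rw [incompleteBeta_zero]
      constructor <;> linarith)
  have hxe' : 2 * incompleteBeta p q x = incompleteBeta p q 1 := by linarith
  rw [median_betaMeasure_eq hx.1.le hx.2.le hxe']
  exact ⟨hx, hxe'⟩

lemma median_betaMeasure_swap (p q : ℕ) :
    median (betaMeasure (q + 1) (p + 1)) = 1 - median (betaMeasure (p + 1) (q + 1)) := by
  obtain ⟨⟨h0, h1⟩, h⟩ := median_betaMeasure_spec p q
  refine median_betaMeasure_eq (by linarith) (by linarith) ?_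
  have := incompleteBeta_one_sub q p 0
  rw [incompleteBeta_zero, sub_zero, sub_zero] at this
  rw [incompleteBeta_one_sub]
  linarith

lemma mode_lt_median_betaMeasure {p q : ℕ} (hpq : p < q) :
    (p : ℝ) / (p + q) < median (betaMeasure (p + 1) (q + 1)) := by
  obtain ⟨⟨h0, h1⟩, h⟩ := median_betaMeasure_spec p q
  have hm : (p : ℝ) / (p + q) ∈ Set.Icc (0 : ℝ) 1 :=
    ⟨by positivity, div_le_one_of_le₀ (by linarith [q.cast_nonneg (α := ℝ)]) (by positivity)⟩
  rw [← (strictMonoOn_incompleteBeta p q).lt_iff_lt hm ⟨h0.le, h1.le⟩]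
  linarith [two_mul_incompleteBeta_mode_lt hpq]

lemma median_betaMeasure_lt_mean {p q : ℕ} (hpq : p < q) :
    median (betaMeasure (p + 1) (q + 1)) < ((p : ℝ) + 1) / (p + q + 2) := by
  obtain ⟨⟨h0, h1⟩, h⟩ := median_betaMeasure_spec p q
  have hm : ((p : ℝ) + 1) / (p + q + 2) ∈ Set.Icc (0 : ℝ) 1 :=
    ⟨by positivity, div_le_one_of_le₀ (by linarith [q.cast_nonneg (α := ℝ)]) (by positivity)⟩
  rw [← (strictMonoOn_incompleteBeta p q).lt_iff_lt ⟨h0.le, h1.le⟩ hm]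
  linarith [lt_two_mul_incompleteBeta_mean hpq]

lemma incompleteBeta_zero_right (p : ℕ) (x : ℝ) :
    incompleteBeta p 0 x = x ^ (p + 1) / (p + 1) := by
  simp [incompleteBeta, betaKernel]

lemma median_betaMeasure_one_right (p : ℕ) :
    median (betaMeasure (p + 1) 1) = Real.exp (-Real.log 2 / (p + 1)) := by
  have h : 2 * incompleteBeta p 0 (Real.exp (-Real.log 2 / (p + 1))) = incompleteBeta p 0 1 := by
    rw [incompleteBeta_zero_right, incompleteBeta_zero_right, ← Real.exp_nat_mul]
    push_cast
    rw [mul_div_cancel₀ _ (by positivity), Real.exp_neg, Real.exp_log two_pos]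
    field_simp
    simp
  have := median_betaMeasure_eq (Real.exp_pos _).le (Real.exp_le_one_iff.2 ?_) h
  · simpa using this
  · exact div_nonpos_of_nonpos_of_nonneg (by linarith [Real.log_pos one_lt_two]) (by positivity)

/-! ### Plotting positions -/

lemma betaMedianPos_add_one (p q : ℕ) :
    betaMedianPos (p + q + 1) (p + 1) = median (betaMeasure (p + 1) (q + 1)) := by
  rw [betaMedianPos]
  congr 2
  · push_cast
    ring
  · push_cast
    ring

lemma betaMedianPos_mem_Ioo {n i : ℕ} (h₁ : 1 ≤ i) (h₂ : i ≤ n) :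
    betaMedianPos n i ∈ Set.Ioo (0 : ℝ) 1 := by
  obtain ⟨p, rfl⟩ := Nat.exists_eq_add_of_le' h₁
  obtain ⟨q, rfl⟩ := Nat.exists_eq_add_of_le' h₂
  rw [show q + (p + 1) = p + q + 1 by ring, betaMedianPos_add_one]
  exact (median_betaMeasure_spec p q).1

lemma betaMedianPos_reflect {n i : ℕ} (h₁ : 1 ≤ i) (h₂ : i ≤ n) :
    betaMedianPos n (n + 1 - i) = 1 - betaMedianPos n i := by
  obtain ⟨p, rfl⟩ := Nat.exists_eq_add_of_le' h₁
  obtain ⟨q, rfl⟩ := Nat.exists_eq_add_of_le' h₂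
  rw [show q + (p + 1) + 1 - (p + 1) = q + 1 by omega, show q + (p + 1) = p + q + 1 by ring,
    betaMedianPos_add_one, show p + q + 1 = q + p + 1 by ring, betaMedianPos_add_one,
    median_betaMeasure_swap]

lemma weibullPos_reflect {n i : ℕ} (h : i ≤ n) :
    weibullPos n (n + 1 - i) = 1 - weibullPos n i := by
  rw [weibullPos, weibullPos, Nat.cast_sub (by omega)]
  push_cast
  field_simp

lemma betaMedianPos_lt_weibullPos {n i : ℕ} (h₁ : 1 ≤ i) (h₂ : 2 * i < n + 1) :
    betaMedianPos n i < weibullPos n i := by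
  obtain ⟨p, rfl⟩ := Nat.exists_eq_add_of_le' h₁
  obtain ⟨q, rfl⟩ := Nat.exists_eq_add_of_le' (show p + 1 ≤ n by omega)
  rw [show q + (p + 1) = p + q + 1 by ring, betaMedianPos_add_one]
  refine (median_betaMeasure_lt_mean (by omega)).trans_eq ?_
  rw [weibullPos]
  push_cast
  ring

lemma div_lt_betaMedianPos {n i : ℕ} (h₁ : 1 ≤ i) (h₂ : 2 * i < n + 1) :
    ((i : ℝ) - 1) / (n - 1) < betaMedianPos n i := by
  obtain ⟨p, rfl⟩ := Nat.exists_eq_add_of_le' h₁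
  obtain ⟨q, rfl⟩ := Nat.exists_eq_add_of_le' (show p + 1 ≤ n by omega)
  rw [show q + (p + 1) = p + q + 1 by ring, betaMedianPos_add_one]
  refine Eq.trans_lt ?_ (mode_lt_median_betaMeasure (by omega))
  push_cast
  ring

lemma weibullPos_lt_betaMedianPos {n i : ℕ} (h₁ : i ≤ n) (h₂ : n + 1 < 2 * i) :
    weibullPos n i < betaMedianPos n i := by
  have h := betaMedianPos_lt_weibullPos (n := n) (i := n + 1 - i) (by omega) (by omega)
  rw [betaMedianPos_reflect (by omega) h₁, weibullPos_reflect h₁] at h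
  linarith

lemma weibullPos_eq_betaMedianPos {n i : ℕ} (h : 2 * i = n + 1) :
    weibullPos n i = betaMedianPos n i := by
  have hB := betaMedianPos_reflect (n := n) (i := i) (by omega) (by omega)
  have hW := weibullPos_reflect (n := n) (i := i) (by omega)
  rw [show n + 1 - i = i by omega] at hB hW
  linarith

lemma abs_weibullPos_sub_betaMedianPos_lt {n i : ℕ} (hn : 2 < n) (h₁ : 1 ≤ i) (h₂ : i ≤ n)
    (h : 2 * i ≠ n + 1) :
    |weibullPos n i - betaMedianPos n i| < |(n : ℝ) + 1 - 2 * i| / ((n : ℝ) ^ 2 - 1) := by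
  have hn' : (2 : ℝ) < n := by exact_mod_cast hn
  have hn1 : (n : ℝ) - 1 ≠ 0 := by linarith
  have low : ∀ j : ℕ, 1 ≤ j → 2 * j < n + 1 → |weibullPos n j - betaMedianPos n j| <
      |(n : ℝ) + 1 - 2 * j| / ((n : ℝ) ^ 2 - 1) := fun j hj hj' => by
    have hj'' : 2 * (j : ℝ) < n + 1 := by exact_mod_cast hj'
    rw [abs_of_pos (sub_pos.2 (betaMedianPos_lt_weibullPos hj hj')), abs_of_pos (by linarith)]
    -- The bound is exactly mean minus mode.
    have e : ((n : ℝ) + 1 - 2 * j) / ((n : ℝ) ^ 2 - 1) =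
        weibullPos n j - ((j : ℝ) - 1) / (n - 1) := by
      rw [weibullPos, show (n : ℝ) ^ 2 - 1 = (n + 1) * (n - 1) by ring]
      field_simp
      ring
    rw [e]
    linarith [div_lt_betaMedianPos hj hj']
  rcases lt_or_gt_of_ne h with h' | h'
  · exact low i h₁ h'
  · have := low (n + 1 - i) (by omega) (by omega)
    rw [betaMedianPos_reflect h₁ h₂, weibullPos_reflect h₂, Nat.cast_sub (by omega),
      ← abs_neg, ← abs_neg ((n : ℝ) + 1 - _)] at this
    push_cast at this
    convert! this using 2
    · ring_nf
    · ring_nf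

/-! ### Limits of the extreme ratios -/

/-- The ratio is (n+1)(1 - 2^(-1/n)), essentially a difference quotient at 0 of exp(-t log 2) with
step 1/n. -/
lemma tendsto_one_sub_betaMedianPos_div_one_sub_weibullPos :
    Tendsto (fun n : ℕ => (1 - betaMedianPos n n) / (1 - weibullPos n n)) atTop
      (𝓝 (Real.log 2)) := by
  have hexp : Tendsto (fun t : ℝ => t⁻¹ * (Real.exp (-Real.log 2 * t) - 1)) (𝓝[≠] 0)
      (𝓝 (-Real.log 2)) := by
    have h : HasDerivAt (fun t : ℝ => Real.exp (-Real.log 2 * t)) (-Real.log 2) 0 := by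
      simpa using ((hasDerivAt_id (0 : ℝ)).const_mul (-Real.log 2)).exp
    simpa [hasDerivAt_iff_tendsto_slope_zero] using h
  have hinv : Tendsto (fun n : ℕ => ((n : ℝ) + 1)⁻¹) atTop (𝓝[≠] 0) := by
    refine tendsto_nhdsWithin_iff.2 ⟨?_, Eventually.of_forall fun n => ?_⟩
    · simpa using tendsto_one_div_add_atTop_nhds_zero_nat (𝕜 := ℝ)
    · exact (by positivity : ((n : ℝ) + 1)⁻¹ ≠ 0)
  -- After the shift n ↦ n+1, this factor corrects the n+1 of the difference quotient to n+2.
  have hfac : Tendsto (fun n : ℕ => 1 + ((n : ℝ) + 1)⁻¹) atTop (𝓝 1) := by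
    simpa using (hinv.mono_right nhdsWithin_le_nhds).const_add 1
  rw [← tendsto_add_atTop_iff_nat 1]
  have h := ((hexp.comp hinv).neg.mul hfac)
  rw [neg_neg, mul_one] at h
  refine h.congr fun n => ?_
  have hB : betaMedianPos (n + 1) (n + 1) = Real.exp (-Real.log 2 * ((n : ℝ) + 1)⁻¹) := by
    have := betaMedianPos_add_one n 0
    rw [add_zero] at this
    rw [this, ← div_eq_mul_inv, ← median_betaMeasure_one_right]
    simp
  have hW : 1 - weibullPos (n + 1) (n + 1) = ((n : ℝ) + 2)⁻¹ := by
    rw [weibullPos]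
    push_cast
    field_simp
    ring
  rw [hB, hW]
  simp only [Function.comp_apply]
  field_simp
  ring

lemma tendsto_betaMedianPos_one_div_weibullPos :
    Tendsto (fun n : ℕ => betaMedianPos n 1 / weibullPos n 1) atTop (𝓝 (Real.log 2)) := by
  refine tendsto_one_sub_betaMedianPos_div_one_sub_weibullPos.congr' ?_
  filter_upwards [eventually_ge_atTop 1] with n hn
  rw [← betaMedianPos_reflect hn le_rfl, ← weibullPos_reflect le_rfl, Nat.add_sub_cancel_left]

/-! ### Assembly -/

theorem mainTheorem4 :
    (∀ n : ℕ, 2 < n →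
      -- (a) lower half
      (∀ i : ℕ, 1 ≤ i → i ≤ n / 2 →
        0 < weibullPos n i - betaMedianPos n i ∧
        weibullPos n i - betaMedianPos n i < |(n : ℝ) + 1 - 2 * i| / ((n : ℝ) ^ 2 - 1)) ∧
      -- (b) upper half, the middle index of an odd `n` excluded
      (∀ i : ℕ, n / 2 + 1 ≤ i → i ≤ n → 2 * i ≠ n + 1 →
        0 < betaMedianPos n i - weibullPos n i ∧
        betaMedianPos n i - weibullPos n i < |(n : ℝ) + 1 - 2 * i| / ((n : ℝ) ^ 2 - 1)) ∧
      -- (c) middle index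
      (∀ i : ℕ, 2 * i = n + 1 → weibullPos n i = betaMedianPos n i) ∧
      -- (d) uniform bound
      (∀ i : ℕ, 1 ≤ i → i ≤ n →
        |weibullPos n i - betaMedianPos n i| < 1 / ((n : ℝ) + 1) ∧
        |(n : ℝ) + 1 - 2 * i| / ((n : ℝ) ^ 2 - 1) ≤ 1 / ((n : ℝ) + 1)) ∧
      -- (e) extreme positions
      (0 < betaMedianPos n 1 ∧ betaMedianPos n 1 < weibullPos n 1 ∧ weibullPos n 1 < 1 ∧
        0 < weibullPos n n ∧ weibullPos n n < betaMedianPos n n ∧ betaMedianPos n n < 1) ∧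
      -- (f) interlacing on the lower half
      (∀ i : ℕ, 2 ≤ i → i ≤ n / 2 →
        weibullPos n (i - 1) < betaMedianPos n i ∧ betaMedianPos n i < weibullPos n i) ∧
      -- (g) interlacing on the upper half
      (∀ i : ℕ, n / 2 + 1 ≤ i → i ≤ n - 1 →
        betaMedianPos n (i - 1) < weibullPos n i ∧
        (2 * i ≠ n + 1 → weibullPos n i < betaMedianPos n i) ∧
        betaMedianPos n i < weibullPos n (i + 1)) ∧
      -- (h) relative error of `p`
      (∀ i : ℕ, 1 ≤ i → i ≤ n →
        (2 * i ≠ n + 1 → |betaMedianPos n i / weibullPos n i - 1| <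
          |(n : ℝ) + 1 - 2 * i| / ((i : ℝ) * ((n : ℝ) - 1))) ∧
        |(n : ℝ) + 1 - 2 * i| / ((i : ℝ) * ((n : ℝ) - 1)) ≤ 1 / (i : ℝ) ∧
        (1 < i → i < n →
          |(n : ℝ) + 1 - 2 * i| / ((i : ℝ) * ((n : ℝ) - 1)) < 1 / (i : ℝ)) ∧
        |betaMedianPos n i / weibullPos n i - 1| < 1 / (i : ℝ)) ∧
      -- (i) relative error of `1 - p`
      (∀ i : ℕ, 1 ≤ i → i ≤ n →
        (2 * i ≠ n + 1 → |(1 - betaMedianPos n i) / (1 - weibullPos n i) - 1| <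
          |(n : ℝ) + 1 - 2 * i| / (((n : ℝ) + 1 - i) * ((n : ℝ) - 1))) ∧
        |(n : ℝ) + 1 - 2 * i| / (((n : ℝ) + 1 - i) * ((n : ℝ) - 1)) ≤
          1 / ((n : ℝ) + 1 - i) ∧
        (1 < i → i < n →
          |(n : ℝ) + 1 - 2 * i| / (((n : ℝ) + 1 - i) * ((n : ℝ) - 1)) <
            1 / ((n : ℝ) + 1 - i)) ∧
        (i < n →
          |(n : ℝ) + 1 - 2 * i| / (((n : ℝ) + 1 - i) * ((n : ℝ) - 1)) <
            1 / ((n : ℝ) - i)) ∧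
        |(1 - betaMedianPos n i) / (1 - weibullPos n i) - 1| < 1 / ((n : ℝ) + 1 - i))) ∧
    -- (j) limits
    Tendsto (fun n : ℕ => betaMedianPos n 1 / weibullPos n 1) atTop (𝓝 (Real.log 2)) ∧
    Tendsto (fun n : ℕ => (1 - betaMedianPos n n) / (1 - weibullPos n n)) atTop
      (𝓝 (Real.log 2)) := by
  refine ⟨fun n hn => ?_, tendsto_betaMedianPos_one_div_weibullPos,
    tendsto_one_sub_betaMedianPos_div_one_sub_weibullPos⟩
  have hn' : (2 : ℝ) < n := by exact_mod_cast hn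
  have hn1 : (0 : ℝ) < (n : ℝ) - 1 := by linarith
  have hn2 : (0 : ℝ) < (n : ℝ) + 1 := by linarith
  have hlow : ∀ i : ℕ, 1 ≤ i → 2 * i < n + 1 → betaMedianPos n i < weibullPos n i :=
    fun i h1 h2 => betaMedianPos_lt_weibullPos h1 h2
  have hhigh : ∀ i : ℕ, i ≤ n → n + 1 < 2 * i → weibullPos n i < betaMedianPos n i :=
    fun i h1 h2 => weibullPos_lt_betaMedianPos h1 h2
  have hne : ∀ i : ℕ, 1 ≤ i → i ≤ n → 2 * i ≠ n + 1 → |weibullPos n i - betaMedianPos n i| <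
      |(n : ℝ) + 1 - 2 * i| / ((n : ℝ) ^ 2 - 1) :=
    fun i h1 h2 h3 => abs_weibullPos_sub_betaMedianPos_lt hn h1 h2 h3
  have hmid : ∀ i : ℕ, 2 * i = n + 1 → weibullPos n i = betaMedianPos n i :=
    fun i h => weibullPos_eq_betaMedianPos h
  have habs : ∀ i : ℕ, 1 ≤ i → i ≤ n → |(n : ℝ) + 1 - 2 * i| ≤ n - 1 := fun i h1 h2 => by
    have h1' : (1 : ℝ) ≤ i := by exact_mod_cast h1
    have h2' : (i : ℝ) ≤ n := by exact_mod_cast h2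
    exact abs_le.2 ⟨by linarith, by linarith⟩
  have habs' : ∀ i : ℕ, 1 < i → i < n → |(n : ℝ) + 1 - 2 * i| < n - 1 := fun i h1 h2 => by
    have h1' : (1 : ℝ) < i := by exact_mod_cast h1
    have h2' : (i : ℝ) < n := by exact_mod_cast h2
    exact abs_lt.2 ⟨by linarith, by linarith⟩
  have hsq : (n : ℝ) ^ 2 - 1 = (n + 1) * (n - 1) := by ring
  have hle : ∀ i : ℕ, 1 ≤ i → i ≤ n → |(n : ℝ) + 1 - 2 * i| / ((n : ℝ) ^ 2 - 1) ≤
      1 / ((n : ℝ) + 1) := fun i h1 h2 => by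
    rw [hsq, div_le_div_iff₀ (by positivity) hn2]
    nlinarith [habs i h1 h2]
  have hd : ∀ i : ℕ, 1 ≤ i → i ≤ n → |weibullPos n i - betaMedianPos n i| < 1 / ((n : ℝ) + 1) :=
    fun i h1 h2 => by
    by_cases h : 2 * i = n + 1
    · rw [hmid i h, sub_self, abs_zero]
      positivity
    · exact (hne i h1 h2 h).trans_le (hle i h1 h2)
  have hratio : ∀ c : ℝ, 0 < c → ∀ i : ℕ, 1 ≤ i → i ≤ n →
      |(n : ℝ) + 1 - 2 * i| / (c * ((n : ℝ) - 1)) ≤ 1 / c := fun c hc i h1 h2 => by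
    rw [div_le_div_iff₀ (by positivity) hc]
    nlinarith [habs i h1 h2]
  have hratio' : ∀ c : ℝ, 0 < c → ∀ i : ℕ, 1 < i → i < n →
      |(n : ℝ) + 1 - 2 * i| / (c * ((n : ℝ) - 1)) < 1 / c := fun c hc i h1 h2 => by
    rw [div_lt_div_iff₀ (by positivity) hc]
    nlinarith [habs' i h1 h2]
  -- The spacing of Weibull positions equals the bound in (d), which yields the interlacing in (f)
  -- and (g).
  have hsucc : ∀ i : ℕ, weibullPos n (i + 1) = weibullPos n i + 1 / ((n : ℝ) + 1) := fun i => by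
    simp only [weibullPos]
    push_cast
    ring
  -- Both p^W and 1 - p^W have the form w/(n+1), with w = i or w = n+1-i, so (h) and (i) share one
  -- computation.
  have hmul : ∀ x y w c : ℝ, 0 < w → |y - x| < c / (n + 1) → |x - y| / (w / (n + 1)) < c / w :=
    fun x y w c hw h => by
    rw [div_div_eq_mul_div, abs_sub_comm]
    gcongr
    rwa [lt_div_iff₀ hn2] at h
  have hrel : ∀ x y w : ℝ, 0 < w → y = w / (n + 1) → |x / y - 1| = |x - y| / (w / (n + 1)) :=
    fun x y w hw hy => by
    have hy0 : 0 < y := by rw [hy]; positivity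
    rw [← hy, div_sub_one hy0.ne', abs_div, abs_of_pos hy0]
  have hsplit : ∀ c w : ℝ, c / ((n : ℝ) ^ 2 - 1) = c / (n - 1) / (n + 1) ∧
      c / (w * ((n : ℝ) - 1)) = c / (n - 1) / w := fun c w => by
    rw [hsq, div_div, div_div, mul_comm w, mul_comm ((n : ℝ) + 1)]
    exact ⟨rfl, rfl⟩
  refine ⟨fun i h1 h2 => ?_, fun i h1 h2 h3 => ?_, hmid, fun i h1 h2 => ⟨hd i h1 h2, hle i h1 h2⟩,
    ?_, fun i h1 h2 => ?_, fun i h1 h2 => ?_, fun i h1 h2 => ?_, fun i h1 h2 => ?_⟩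
  · exact ⟨sub_pos.2 (hlow i h1 (by omega)),
      (le_abs_self _).trans_lt (hne i h1 (by omega) (by omega))⟩
  · refine ⟨sub_pos.2 (hhigh i h2 (by omega)), (le_abs_self _).trans_lt ?_⟩
    rw [abs_sub_comm]
    exact hne i (by omega) h2 h3
  · refine ⟨(betaMedianPos_mem_Ioo le_rfl (by omega)).1, hlow 1 le_rfl (by omega), ?_, ?_,
      hhigh n le_rfl (by omega), (betaMedianPos_mem_Ioo (by omega) le_rfl).2⟩
    · rw [weibullPos, div_lt_one hn2]
      push_cast
      linarith
    · exact div_pos (by linarith) hn2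
  · obtain ⟨j, rfl⟩ : ∃ j, i = j + 1 := ⟨i - 1, by omega⟩
    refine ⟨?_, hlow _ (by omega) (by omega)⟩
    have := (abs_lt.1 (hd (j + 1) (by omega) (by omega))).2
    rw [hsucc] at this
    rw [Nat.add_sub_cancel]
    linarith
  · obtain ⟨j, rfl⟩ : ∃ j, i = j + 1 := ⟨i - 1, by omega⟩
    refine ⟨?_, fun h => hhigh _ (by omega) (by omega), ?_⟩
    · have := (abs_lt.1 (hd j (by omega) (by omega))).1
      rw [hsucc, Nat.add_sub_cancel]
      linarith
    · have := (abs_lt.1 (hd (j + 1) (by omega) (by omega))).1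
      rw [hsucc (j + 1)]
      linarith
  · have hi : (0 : ℝ) < i := by exact_mod_cast h1
    rw [hrel _ (weibullPos n i) i hi rfl]
    refine ⟨fun h => ?_, hratio i hi i h1 h2, hratio' i hi i, hmul _ _ _ _ hi (hd i h1 h2)⟩
    rw [(hsplit _ _).2]
    refine hmul _ _ _ _ hi ?_
    rw [← (hsplit _ i).1]
    exact hne i h1 h2 h
  · have hi : (0 : ℝ) < (n : ℝ) + 1 - i := by
      have : (i : ℝ) ≤ n := by exact_mod_cast h2
      linarith
    have hcomm : ∀ x y : ℝ, (1 - x) - (1 - y) = y - x := fun x y => by ring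
    have hW : 1 - weibullPos n i = ((n : ℝ) + 1 - i) / (n + 1) := by
      rw [weibullPos]
      field_simp
    rw [hrel _ _ _ hi hW, hcomm]
    refine ⟨fun h => ?_, hratio _ hi i h1 h2, hratio' _ hi i, fun h => ?_, ?_⟩
    · rw [(hsplit _ _).2]
      refine hmul _ _ _ _ hi ?_
      rw [← (hsplit _ i).1, abs_sub_comm (betaMedianPos n i)]
      exact hne i h1 h2 h
    · refine (hratio _ hi i h1 h2).trans_lt ?_
      have : (i : ℝ) < n := by exact_mod_cast h
      exact one_div_lt_one_div_of_lt (by linarith) (by linarith)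
    · refine hmul _ _ _ _ hi ?_
      rw [abs_sub_comm]
      exact hd i h1 h2
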